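/- Let $X$ be a Tychonoff space, and let $C(X)$ be the real vector space of all continuous functions $X\to\mathbb{R}$. Write $C_p(X)$ for $C(X)$ with the topology of pointwise convergence and $C_k(X)$ for $C(X)$ with the compact-open topology. The following conditions are equivalent: 1. $C_p(X)$ is Polishable, that is, there is a topology on $C(X)$, finer than or equal to the topology of pointwise convergence, which makes $C(X)$ a separable Fréchet space (a separable, complete, metrizable, locally convex topological vector space); 2. $C_k(X)$ is a Polish space (separable and completely metrizable); 3. $X$ is a submetrizable hemicompact $k$-space. Here $X$ is *submetrizable* if there is a metric on the set $X$ which is continuous as a function on $X\times X$; *hemicompact* if there is a countable family $\mathcal{K}$ of compact subsets of $X$ such that each compact subset of $X$ is contained in some $K\in\mathcal{K}$; and a *$k$-space* if a subset $F\subseteq X$ is closed if and only if $F\cap K$ is closed in $K$ for every compact subset $K\subseteq X$. -/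

import Mathlib

namespace FunctionSpace

/-- A Fréchet (locally convex) space: a real topological vector space that is locally convex,
metrizable, and complete for its canonical uniformity, in which `x` and `y` are close when
`y - x` is close to `0`. -/
structure IsFrechet (E : Type*) [AddCommGroup E] [Module ℝ E] [TopologicalSpace E] : Prop where
  isTopologicalAddGroup : IsTopologicalAddGroup E
  continuousSMul : ContinuousSMul ℝ E
  locallyConvexSpace : LocallyConvexSpace ℝ E
  metrizableSpace : TopologicalSpace.MetrizableSpace E
  completeSpace : @CompleteSpace E (IsTopologicalAddGroup.rightUniformSpace E)

/-- A real vector space `E` with the topology `t` is Polishable if there is on `E` a topology `τ`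
which is finer than (or equal to) `t` and makes `E` a separable Fréchet space. -/
def IsPolishable (E : Type*) [AddCommGroup E] [Module ℝ E] (t : TopologicalSpace E) : Prop :=
  ∃ τ : TopologicalSpace E, τ ≤ t ∧ @IsFrechet E _ _ τ ∧ @TopologicalSpace.SeparableSpace E τ

/-- The topology of pointwise convergence on the vector space of continuous real-valued functions
on `X`, that is, the subspace topology from the product `ℝ ^ X`. (The global topology instance on
`C(X, ℝ)` is the compact-open topology.) -/
abbrev pointwiseTopology (X : Type*) [TopologicalSpace X] : TopologicalSpace C(X, ℝ) :=
  TopologicalSpace.induced (fun (f : C(X, ℝ)) (x : X) => f x) Pi.topologicalSpace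

/-- `X` is submetrizable: there is a metric `d` on the set `X` that is continuous as a function on
the product `X × X`. (Nonnegativity of `d` follows from the other axioms.) -/
def IsSubmetrizable (X : Type*) [TopologicalSpace X] : Prop :=
  ∃ d : X → X → ℝ, Continuous (fun p : X × X => d p.1 p.2) ∧
    (∀ x y, d x y = 0 ↔ x = y) ∧ (∀ x y, d x y = d y x) ∧ ∀ x y z, d x z ≤ d x y + d y z

/-- `X` is hemicompact: there is a countable family of compact sets such that each compact subset
of `X` is contained in a member of the family. -/
def IsHemicompact (X : Type*) [TopologicalSpace X] : Prop :=
  ∃ 𝒦 : Set (Set X), 𝒦.Countable ∧ (∀ K ∈ 𝒦, IsCompact K) ∧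
    ∀ C : Set X, IsCompact C → ∃ K ∈ 𝒦, C ⊆ K

/-- `X` is a k-space: a set `F` is closed if and only if `F ∩ K` is closed in `K` for every
compact `K`. -/
def IsKSpace (X : Type*) [TopologicalSpace X] : Prop :=
  ∀ F : Set X, IsClosed F ↔
    ∀ K : Set X, IsCompact K → IsClosed ((fun x : K => (x : X)) ⁻¹' F)

end FunctionSpace

/-!
Let `τ` be a separable Fréchet topology on `C(X, ℝ)` finer than pointwise convergence, and let
`X n` be the set of points whose evaluations lie in the polar of the `n`-th member of a
neighbourhood base of zero. These closed sets cover `X`, and separability makes each of them second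
countable, so `X` is Lindelöf; every continuous function is bounded on `X n`, so `X n` is compact.
A compact set defines a seminorm that is `τ`-continuous because `τ` is barrelled, so it lies in
some `X n`: this is hemicompactness.

For the `k`-property, let `p` be a `τ`-continuous seminorm. The map `g ↦ f * g` from bounded
functions to `C(X, ℝ)` is `τ`-continuous, since it is Borel by the Lusin-Souslin theorem and Pettis'
lemma applies. Hence `p` is bounded on order intervals, which forces it to have compact support.
A sequence of functions that stabilizes on each `X n` is therefore `τ`-Cauchy, so functions can be
glued along the `X n`, and Tietze extension separates points from `k`-closed sets.

Conversely, `C(X, ℝ)` is complete over a `k`-space, and hemicompactness makes it a countable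
projective limit of separable Banach spaces `C(K, ℝ)`. If `C(X, ℝ)` is Polish in the compact-open
topology, then it is complete by Klee's theorem.
-/

namespace FunctionSpace

open Filter Set Topology Uniformity Pointwise

theorem isGδ_range_of_isDenseInducing {Z Y : Type*} [TopologicalSpace Z]
    [TopologicalSpace.IsCompletelyMetrizableSpace Z] [TopologicalSpace Y] [T2Space Y] {e : Z → Y}
    (he : IsDenseInducing e) : IsGδ (range e) := by
  let _ := TopologicalSpace.upgradeIsCompletelyMetrizable Z
  let O : ℕ → Set Y := fun n =>
    ⋃₀ {U | IsOpen U ∧ ∀ a ∈ e ⁻¹' U, ∀ b ∈ e ⁻¹' U, dist a b < 1 / ((n : ℝ) + 1)}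
  have hsub : range e ⊆ ⋂ n, O n := by
    rintro _ ⟨z, rfl⟩
    refine mem_iInter.2 fun n => ?_
    obtain ⟨U, hU, hUe⟩ := he.toIsInducing.isOpen_iff.1
      (Metric.isOpen_ball (x := z) (ε := 1 / ((n : ℝ) + 1) / 2))
    refine mem_sUnion.2 ⟨U, ⟨hU, ?_⟩, ?_⟩
    · rw [hUe]
      intro a ha b hb
      exact (dist_triangle_right a b z).trans_lt ((add_lt_add ha hb).trans_eq (add_halves _))
    · exact mem_preimage.1 (hUe ▸ Metric.mem_ball_self (by positivity))
  -- Points of `⋂ n, O n` are exactly those whose neighbourhood filter pulls back to a Cauchy one.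
  have hsup : ⋂ n, O n ⊆ range e := by
    intro y hy
    have hcauchy : Cauchy (comap e (𝓝 y)) := by
      refine Metric.cauchy_iff.2 ⟨he.comap_nhds_neBot y, fun ε hε => ?_⟩
      obtain ⟨n, hn⟩ := exists_nat_one_div_lt hε
      obtain ⟨U, ⟨hU, hdist⟩, hyU⟩ := mem_sUnion.1 (mem_iInter.1 hy n)
      exact ⟨e ⁻¹' U, preimage_mem_comap (hU.mem_nhds hyU),
        fun a ha b hb => (hdist a ha b hb).trans hn⟩
    have := he.comap_nhds_neBot y
    obtain ⟨z, hz⟩ := CompleteSpace.complete hcauchy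
    exact ⟨z, tendsto_nhds_unique ((he.continuous.tendsto z).mono_left hz) tendsto_comap⟩
  rw [hsub.antisymm hsup]
  exact IsGδ.iInter_of_isOpen fun n => isOpen_sUnion fun U hU => hU.1

/-- **Klee's theorem** for abelian groups: the completion contains `G` and each of its translates
as a dense `Gδ` set, and by Baire's theorem two of those always meet. -/
theorem completeSpace_of_isCompletelyMetrizableSpace {G : Type*} [AddCommGroup G] [UniformSpace G]
    [IsUniformAddGroup G] [TopologicalSpace.IsCompletelyMetrizableSpace G] :
    CompleteSpace G := by
  let c : G → UniformSpace.Completion G := (↑)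
  have hc : IsDenseInducing c := UniformSpace.Completion.isDenseInducing_coe
  have : (𝓤 (UniformSpace.Completion G)).IsCountablyGenerated := by
    obtain ⟨b, hb⟩ := (𝓝 (0 : G)).exists_antitone_basis
    have := (hb.1.hasBasis_of_isDenseInducing hc).isCountablyGenerated
    exact IsUniformAddGroup.uniformity_countably_generated
  have hG : IsGδ (range c) := isGδ_range_of_isDenseInducing hc
  have hsurj : Function.Surjective c := by
    intro z
    have hG' : IsGδ ((z - ·) ⁻¹' range c) := hG.preimage (by fun_prop)
    have hdense : Dense ((z - ·) ⁻¹' range c) :=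
      hc.dense.preimage (Homeomorph.subLeft z).isOpenMap
    obtain ⟨_, ⟨a, rfl⟩, b, hb⟩ := (Dense.inter_of_Gδ hG hG' hc.dense hdense).nonempty
    refine ⟨a + b, ?_⟩
    calc c (a + b) = c a + c b := UniformSpace.Completion.coe_add a b
      _ = c a + (z - c a) := by rw [hb]
      _ = z := add_sub_cancel _ _
  have hind : IsUniformInducing c := UniformSpace.Completion.isUniformInducing_coe G
  exact (hind.completeSpace_congr hsurj).2 inferInstance

section AutomaticContinuity

variable {G : Type*} [AddCommGroup G] [TopologicalSpace G] [IsTopologicalAddGroup G] [BaireSpace G]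

/-- **Pettis' lemma**. -/
theorem sub_mem_nhds_zero_of_not_isMeagre {S : Set G} (hS : BaireMeasurableSet S)
    (hSm : ¬ IsMeagre S) : S - S ∈ 𝓝 0 := by
  obtain ⟨O, hO, hSO⟩ := hS.residualEq_isOpen
  have hOne : O.Nonempty := by
    by_contra! hempty
    rw [hempty] at hSO
    exact hSm (eventuallyEq_empty.1 hSO)
  obtain ⟨a, ha⟩ := hOne
  have hnear : ∀ᶠ g in 𝓝 (0 : G), a + g ∈ O :=
    (show Continuous fun g => a + g by fun_prop).continuousAt.eventually
      (hO.mem_nhds (by simpa using ha))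
  filter_upwards [hnear] with g hg
  have hSO' : (· + g) ⁻¹' S =ᵇ (· + g) ⁻¹' O :=
    hSO.comp_tendsto (tendsto_residual_of_isOpenMap (by fun_prop) (isOpenMap_add_right g))
  have hdense : Dense {x | (x ∈ S ↔ x ∈ O) ∧ (x + g ∈ S ↔ x + g ∈ O)} :=
    dense_of_mem_residual ((eventuallyEq_set.1 hSO).and (eventuallyEq_set.1 hSO'))
  obtain ⟨x, ⟨hxO, hxgO⟩, hx, hxg⟩ := hdense.inter_open_nonempty
    (O ∩ (· + g) ⁻¹' O) (hO.inter (hO.preimage (by fun_prop))) ⟨a, ha, hg⟩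
  exact ⟨x + g, hxg.2 hxgO, x, hx.2 hxO, add_sub_cancel_left x g⟩

theorem continuous_of_measurable {H : Type*} [AddCommGroup H] [TopologicalSpace H]
    [IsTopologicalAddGroup H] [TopologicalSpace.SeparableSpace H] [MeasurableSpace G]
    [BorelSpace G] [MeasurableSpace H] [OpensMeasurableSpace H] (T : G →+ H) (hT : Measurable T) :
    Continuous T := by
  refine continuous_of_continuousAt_zero T ?_
  rw [ContinuousAt, map_zero]
  intro V hV
  obtain ⟨W, hW, hWV⟩ := exists_nhds_half_neg hV
  obtain ⟨d, hd⟩ := TopologicalSpace.exists_dense_seq H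
  let S : ℕ → Set G := fun i => T ⁻¹' {y | y - d i ∈ interior W}
  have hcover : ⋃ i, S i = univ := by
    refine eq_univ_of_forall fun g => mem_iUnion.2 ?_
    have hopen : IsOpen {y | T g - y ∈ interior W} := isOpen_interior.preimage (by fun_prop)
    exact hd.exists_mem_open hopen ⟨T g, by simpa using mem_interior_iff_mem_nhds.2 hW⟩
  obtain ⟨i, hi⟩ : ∃ i, ¬ IsMeagre (S i) := by
    by_contra! h
    exact not_isMeagre_of_isOpen isOpen_univ univ_nonempty (hcover ▸ isMeagre_iUnion h)
  have hSi : MeasurableSet (S i) :=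
    hT (isOpen_interior.preimage (continuous_id.sub continuous_const)).measurableSet
  have hsub : S i - S i ∈ 𝓝 0 := sub_mem_nhds_zero_of_not_isMeagre hSi.baireMeasurableSet hi
  refine mem_map.2 (mem_of_superset hsub ?_)
  rintro _ ⟨a, ha, b, hb, rfl⟩
  have := hWV _ (interior_subset ha) _ (interior_subset hb)
  rwa [sub_sub_sub_cancel_right, ← map_sub] at this

-- The Lusin-Souslin theorem turns `j` into a Borel embedding, which makes `T` Borel measurable.
theorem continuous_of_comp_injective {H Y : Type*} [AddCommGroup H] [TopologicalSpace H]
    [IsTopologicalAddGroup H] [PolishSpace H] [TopologicalSpace Y] [T2Space Y]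
    (T : G →+ H) {j : H → Y} (hj : Continuous j) (hinj : Function.Injective j)
    (hT : Continuous (j ∘ T)) : Continuous T := by
  borelize G H Y
  exact continuous_of_measurable T
    ((hj.measurableEmbedding hinj).measurable_comp_iff.1 hT.measurable)

end AutomaticContinuity

section Lindelof
variable {X : Type*} [TopologicalSpace X]

theorem exists_bump [CompletelyRegularSpace X] {V : Set X} (hV : IsOpen V) {x : X} (hx : x ∈ V) :
    ∃ h : C(X, ℝ), (∀ y, h y ∈ Icc 0 1) ∧ h x = 1 ∧ ∀ y ∉ V, h y = 0 := by
  obtain ⟨f, hf, hfx, hfV⟩ := CompletelyRegularSpace.completely_regular_isOpen x V hV hx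
  refine ⟨⟨fun y => 1 - (f y : ℝ), by fun_prop⟩, fun y => ?_, by simp [hfx], fun y hy => ?_⟩
  · exact Icc.mem_iff_one_sub_mem.1 (f y).2
  · simp [hfV hy]

variable [LindelofSpace X] [CompletelyRegularSpace X]

theorem exists_bump_sequence {U : ℕ → Set X} (hUo : ∀ n, IsOpen (U n)) (hU : ∀ x, ∃ n, x ∈ U n) :
    ∃ (m : ℕ → ℕ) (h : ℕ → C(X, ℝ)), (∀ i x, h i x ∈ Icc 0 1) ∧
      (∀ i, ∀ x ∉ U (m i), h i x = 0) ∧ ∀ x, ∃ i, 0 < h i x := by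
  rcases isEmpty_or_nonempty X with _ | _
  · exact ⟨0, 0, by simp, by simp, isEmptyElim⟩
  choose m hm using hU
  choose h h01 hone hzero using fun x => exists_bump (hUo (m x)) (hm x)
  obtain ⟨p, hp⟩ := isLindelof_univ.indexed_countable_subcover (fun x => {y | 0 < h x y})
    (fun x => isOpen_lt continuous_const (h x).continuous)
    fun x _ => mem_iUnion.2 ⟨x, by simp [hone]⟩
  exact ⟨m ∘ p, h ∘ p, fun i => h01 (p i), fun i => hzero (p i),
    fun x => mem_iUnion.1 (hp (mem_univ x))⟩

-- `H` is a sum of bumps, the `i`-th of which is supported in `U (m i)` and weighted by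
-- `(1 / 2) ^ (i + m i)`.
theorem exists_pos_le_geometric {U : ℕ → Set X} (hUo : ∀ n, IsOpen (U n))
    (hU : ∀ x, ∃ n, x ∈ U n) :
    ∃ H : C(X, ℝ), (∀ x, 0 < H x) ∧ ∀ n x, (∀ i < n, x ∉ U i) → H x ≤ 2 * (1 / 2) ^ n := by
  obtain ⟨m, h, h01, hzero, hpos⟩ := exists_bump_sequence hUo hU
  let a : ℕ → X → ℝ := fun i x => (1 / 2) ^ i * ((1 / 2) ^ m i * h i x)
  have ha0 : ∀ i x, 0 ≤ a i x := fun i x => by have := (h01 i x).1; positivity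
  have ha_le : ∀ n x, (∀ i < n, x ∉ U i) → ∀ i, a i x ≤ (1 / 2) ^ i * (1 / 2) ^ n := by
    intro n x hx i
    refine mul_le_mul_of_nonneg_left ?_ (by positivity)
    rcases lt_or_ge (m i) n with hmn | hnm
    · rw [hzero i x (hx _ hmn), mul_zero]
      positivity
    · exact (mul_le_of_le_one_right (by positivity) (h01 i x).2).trans
        (pow_le_pow_of_le_one (by norm_num) (by norm_num) hnm)
  have ha1 : ∀ i x, a i x ≤ (1 / 2) ^ i := fun i x => by simpa using ha_le 0 x (by simp) i
  have hsum : ∀ x, Summable (a · x) := fun x =>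
    .of_nonneg_of_le (ha0 · x) (ha1 · x) summable_geometric_two
  have hcont : Continuous fun x => ∑' i, a i x :=
    continuous_tsum (fun i => by fun_prop) summable_geometric_two fun i x => by
      rw [Real.norm_of_nonneg (ha0 i x)]
      exact ha1 i x
  refine ⟨⟨_, hcont⟩, fun x => ?_, fun n x hx =>
    hasSum_le (ha_le n x hx) (hsum x).hasSum (hasSum_geometric_two.mul_right _)⟩
  obtain ⟨i, hi⟩ := hpos x
  exact (hsum x).tsum_pos (ha0 · x) i (by positivity)

theorem exists_forall_natCast_le {U : ℕ → Set X} (hUo : ∀ n, IsOpen (U n))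
    (hU : ∀ x, ∃ n, x ∈ U n) :
    ∃ u : C(X, ℝ), ∀ (n : ℕ) (x : X), (∀ i < n, x ∉ U i) → n ≤ u x := by
  obtain ⟨H, hpos, hH⟩ := exists_pos_le_geometric hUo hU
  refine ⟨⟨fun x => 2 / H x, continuous_const.div H.continuous fun x => (hpos x).ne'⟩,
    fun n x hx => ?_⟩
  calc (n : ℝ) ≤ 2 ^ n := mod_cast n.lt_two_pow_self.le
    _ = 2 / (2 * (1 / 2) ^ n) := by simp [field]
    _ ≤ 2 / H x := div_le_div_of_nonneg_left zero_le_two (hpos x) (hH n x hx)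

theorem isCompact_of_forall_bounded {S : Set X} (hS : IsClosed S)
    (hb : ∀ g : C(X, ℝ), ∃ M, ∀ x ∈ S, |g x| ≤ M) : IsCompact S := by
  refine isCompact_of_finite_subcover fun {ι} W hW hSW => ?_
  rcases S.eq_empty_or_nonempty with rfl | hne
  · exact ⟨∅, by simp⟩
  have : Nonempty ι := (nonempty_iUnion.1 (hne.mono hSW)).nonempty
  obtain ⟨r, hr⟩ := hS.isLindelof.indexed_countable_subcover W hW hSW
  have hcover : ∀ x, ∃ n, x ∈ Sᶜ ∪ W (r n) := by
    intro x
    by_cases hx : x ∈ S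
    · exact (mem_iUnion.1 (hr hx)).imp fun _ => .inr
    · exact ⟨0, .inl hx⟩
  obtain ⟨u, hu⟩ := exists_forall_natCast_le (fun n => hS.isOpen_compl.union (hW (r n))) hcover
  obtain ⟨M, hM⟩ := hb u
  obtain ⟨n, hn⟩ := exists_nat_gt M
  classical
  refine ⟨(Finset.range n).image r, fun x hx => ?_⟩
  have hxW : ∃ i < n, x ∈ Sᶜ ∪ W (r i) := by
    by_contra! hxW
    exact (hn.trans_le (hu n x hxW)).not_ge ((le_abs_self _).trans (hM x hx))
  simpa [hx] using hxW

end Lindelof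

section Ideal

variable {X : Type*} [TopologicalSpace X] {I : Ideal C(X, ℝ)}

theorem exists_nonneg_mem_ideal {x : X} (hx : x ∈ ContinuousMap.setOfIdeal I) :
    ∃ h ∈ I, (∀ y, 0 ≤ h y) ∧ 1 < h x := by
  obtain ⟨h, hh, hhx⟩ := ContinuousMap.mem_setOfIdeal.1 hx
  refine ⟨(2 / (h x * h x)) • (h * h), Submodule.smul_of_tower_mem _ _ (I.mul_mem_left h hh),
    fun y => ?_, ?_⟩
  · exact mul_nonneg (div_nonneg zero_le_two (mul_self_nonneg _)) (mul_self_nonneg (h y))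
  · simp [hhx]

theorem mem_ideal_of_one_le {g H : C(X, ℝ)} (hH : H ∈ I)
    (hg : ∀ x, g x ≠ 0 → 1 ≤ H x) : g ∈ I := by
  let q : C(X, ℝ) :=
    ⟨fun x => g x / max (H x) 1,
      g.continuous.div (by fun_prop) fun x => (lt_max_of_lt_right one_pos).ne'⟩
  have hgq : g = q * H := by
    ext x
    by_cases hx : g x = 0
    · simp [q, hx]
    · have := hg x hx
      simp [q, max_eq_left this, div_mul_cancel₀ _ (zero_lt_one.trans_le this).ne']
  exact hgq ▸ I.mul_mem_left q hH

theorem exists_forall_mem_ideal [LindelofSpace X] [CompletelyRegularSpace X] {W : Set X}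
    (hW : IsOpen W) (hIW : (ContinuousMap.setOfIdeal I)ᶜ ⊆ W) :
    ∃ u : C(X, ℝ), ∀ (n : ℕ) (g : C(X, ℝ)), (∀ x, g x ≠ 0 → x ∉ W ∧ u x < n) → g ∈ I := by
  let ι := {h : C(X, ℝ) // h ∈ I ∧ ∀ x, 0 ≤ h x}
  let U : ι → Set X := fun h => W ∪ {x | 1 < h.1 x}
  have hU : ∀ h, IsOpen (U h) := fun h => hW.union (isOpen_lt continuous_const h.1.continuous)
  have : Nonempty ι := ⟨0, I.zero_mem, fun _ => le_rfl⟩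
  obtain ⟨h, hcover⟩ := isLindelof_univ.indexed_countable_subcover U hU fun x _ => by
    by_cases hx : x ∈ W
    · exact mem_iUnion.2 ⟨Classical.arbitrary ι, .inl hx⟩
    · obtain ⟨h, hh, h0, hhx⟩ := exists_nonneg_mem_ideal (not_not.1 (notMem_subset hIW hx))
      exact mem_iUnion.2 ⟨⟨h, hh, h0⟩, .inr hhx⟩
  obtain ⟨u, hu⟩ := exists_forall_natCast_le (fun n => hU (h n))
    fun x => mem_iUnion.1 (hcover (mem_univ x))
  refine ⟨u, fun n g hg => mem_ideal_of_one_le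
    (I.sum_mem fun i (_ : i ∈ Finset.range n) => (h i).2.1) fun x hx => ?_⟩
  obtain ⟨hxW, hux⟩ := hg x hx
  obtain ⟨i, hi, hix⟩ : ∃ i < n, x ∈ U (h i) := by
    by_contra! hall
    exact hux.not_ge (hu n x hall)
  rw [ContinuousMap.sum_apply]
  exact (hix.resolve_left hxW).le.trans (Finset.single_le_sum (f := fun i => (h i).1 x)
    (fun j _ => (h j).2.2 x) (Finset.mem_range.2 hi))

end Ideal

section Support

variable {X : Type*} [TopologicalSpace X] {P : Seminorm ℝ C(X, ℝ)}

theorem exists_forall_abs_le_of_locallyFinite {ι : Type*} {h : ι → C(X, ℝ)}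
    (hh : LocallyFinite fun i => Function.support (h i)) :
    ∃ f : C(X, ℝ), ∀ i x, |h i x| ≤ f x := by
  have habs : LocallyFinite fun i => Function.support fun x => |h i x| := by
    simpa only [Function.support, ne_eq, abs_eq_zero] using hh
  refine ⟨⟨fun x => ∑ᶠ i, |h i x|, continuous_finsum (fun i => by fun_prop) habs⟩, fun i x => ?_⟩
  have hfin : (Function.support fun i => |h i x|).Finite := habs.point_finite x
  exact single_le_finsum i hfin fun j => abs_nonneg (h j x)

/-- A seminorm on `C(X, ℝ)` is order bounded if it is bounded on each set of functions dominated
by a given function. This is the trace on `C(X, ℝ)` of continuity for a separable Fréchet topology,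
and it suffices to produce a compact support. -/
def IsOrderBounded (P : Seminorm ℝ C(X, ℝ)) : Prop :=
  ∀ f : C(X, ℝ), ∃ C, ∀ h : C(X, ℝ), (∀ x, |h x| ≤ f x) → P h ≤ C

theorem IsOrderBounded.exists_eq_zero_of_locallyFinite (hP : IsOrderBounded P) {h : ℕ → C(X, ℝ)}
    (hh : LocallyFinite fun n => Function.support (h n)) : ∃ n, P (h n) = 0 := by
  by_contra! hne
  let g : ℕ → C(X, ℝ) := fun n => ((n : ℝ) / P (h n)) • h n
  have hg : LocallyFinite fun n => Function.support (g n) :=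
    hh.subset fun n => Function.support_const_smul_subset _ _
  obtain ⟨f, hf⟩ := exists_forall_abs_le_of_locallyFinite hg
  obtain ⟨C, hC⟩ := hP f
  obtain ⟨n, hn⟩ := exists_nat_gt C
  have hPg : P (g n) = n := by
    rw [map_smul_eq_mul, Real.norm_of_nonneg (by positivity), div_mul_cancel₀ _ (hne n)]
  exact hn.not_ge (hPg ▸ hC (g n) (hf n))

theorem IsOrderBounded.exists_eq_zero (hP : IsOrderBounded P) {h : ℕ → C(X, ℝ)} (u : C(X, ℝ))
    (hu : ∀ (n : ℕ) (x : X), h n x ≠ 0 → n ≤ u x) : ∃ n, P (h n) = 0 := by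
  refine hP.exists_eq_zero_of_locallyFinite fun x => ?_
  have hO : IsOpen {y | u y < u x + 1} := isOpen_lt u.continuous continuous_const
  refine ⟨_, hO.mem_nhds (lt_add_one (u x)), ?_⟩
  refine (finite_Iic ⌈u x + 1⌉₊).subset ?_
  rintro n ⟨y, hny, hy⟩
  exact Nat.cast_le.1 (((hu n y hny).trans (le_of_lt hy)).trans (Nat.le_ceil _))

/-- The functions all of whose multiples are annihilated by `P`: the largest ideal contained in the
kernel of `P`, used to define the support of `P`. -/
def nullIdeal (P : Seminorm ℝ C(X, ℝ)) : Ideal C(X, ℝ) where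
  carrier := {h | ∀ f, P (f * h) = 0}
  add_mem' {a b} ha hb f := by
    refine le_antisymm ?_ (apply_nonneg P _)
    calc P (f * (a + b)) ≤ P (f * a) + P (f * b) := mul_add f a b ▸ map_add_le_add P _ _
      _ = 0 := by rw [ha, hb, add_zero]
  zero_mem' f := by rw [mul_zero, map_zero]
  smul_mem' c a ha f := by rw [smul_eq_mul, ← mul_assoc]; exact ha _

/-- The support of a seminorm on `C(X, ℝ)`: the set of common zeros of its null ideal. If `P` is
order bounded, then it is compact and carries `P`. -/
def seminormSupport (P : Seminorm ℝ C(X, ℝ)) : Set X := (ContinuousMap.setOfIdeal (nullIdeal P))ᶜ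

theorem isClosed_seminormSupport : IsClosed (seminormSupport P) :=
  (ContinuousMap.setOfIdeal_open _).isClosed_compl

theorem eq_zero_of_mem_nullIdeal {h : C(X, ℝ)} (hh : h ∈ nullIdeal P) : P h = 0 := by
  simpa using hh 1

theorem bounded_on_seminormSupport (hP : IsOrderBounded P) (g : C(X, ℝ)) :
    ∃ M, ∀ x ∈ seminormSupport P, |g x| ≤ M := by
  by_contra! hunb
  let χ : ℕ → C(X, ℝ) := fun n => ⟨fun x => max (|g x| - n) 0, by fun_prop⟩
  have hχ : ∀ n, χ n ∉ nullIdeal P := by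
    intro n hn
    obtain ⟨x, hx, hgx⟩ := hunb n
    exact (lt_max_of_lt_left (sub_pos.2 hgx)).ne' (ContinuousMap.notMem_setOfIdeal.1 hx hn)
  have hmul : ∀ n, ∃ F, P (F * χ n) ≠ 0 := fun n => not_forall.1 (hχ n)
  choose F hF using hmul
  obtain ⟨n, hn⟩ := hP.exists_eq_zero (h := fun n => F n * χ n) |g| fun n x hx => by
    by_contra! hlt
    exact hx (mul_eq_zero_of_right _ (max_eq_right (sub_nonpos.2 hlt.le)))
  exact hF n hn

section

variable [LindelofSpace X] [CompletelyRegularSpace X]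

-- Split `f` with cutoffs `w n`: `f * w n` lies in the null ideal, while the functions
-- `f * (1 - w n)` form a locally finite sequence.
theorem IsOrderBounded.eq_zero_of_eqOn_isOpen (hP : IsOrderBounded P) {W : Set X} (hW : IsOpen W)
    (hPW : seminormSupport P ⊆ W) {f : C(X, ℝ)} (hf : ∀ x ∈ W, f x = 0) : P f = 0 := by
  obtain ⟨u, hu⟩ := exists_forall_mem_ideal hW hPW
  let w : ℕ → C(X, ℝ) := fun n => ⟨fun x => max 0 (min (n - u x) 1), by fun_prop⟩
  have hnull : ∀ n, f * w n ∈ nullIdeal P := fun n => hu n _ fun x hx => by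
    obtain ⟨hfx, hwx⟩ := mul_ne_zero_iff.1 hx
    refine ⟨fun hxW => hfx (hf x hxW), ?_⟩
    by_contra! hle
    exact hwx (max_eq_left (min_le_of_left_le (sub_nonpos.2 hle)))
  obtain ⟨n, hn⟩ := hP.exists_eq_zero (h := fun n => f * (1 - w n)) (u + 1) fun n x hx => by
    by_contra! hlt
    have hwx : w n x = 1 := by
      have hle : 1 ≤ n - u x := by linarith [show u x + 1 < n from hlt]
      change max 0 (min (n - u x) 1) = 1
      rw [min_eq_right hle, max_eq_right zero_le_one]
    exact hx (by simp [hwx])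
  refine le_antisymm ?_ (apply_nonneg P f)
  calc P f = P (f * w n + f * (1 - w n)) := by rw [← mul_add, add_sub_cancel, mul_one]
    _ ≤ P (f * w n) + P (f * (1 - w n)) := map_add_le_add P _ _
    _ = 0 := by rw [eq_zero_of_mem_nullIdeal (hnull n), hn, add_zero]

theorem IsOrderBounded.eq_zero_of_eqOn_support (hP : IsOrderBounded P) {f : C(X, ℝ)}
    (hf : ∀ x ∈ seminormSupport P, f x = 0) : P f = 0 := by
  obtain ⟨C, hC⟩ := hP 1
  have hle : ∀ ε > 0, P f ≤ ε * C := by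
    intro ε hε
    let c : C(X, ℝ) := ⟨fun x => max (-ε) (min (f x) ε), by fun_prop⟩
    have hc : P (ε⁻¹ • c) ≤ C := hC _ fun x => by
      rw [ContinuousMap.smul_apply, smul_eq_mul, abs_mul, abs_inv, abs_of_pos hε,
        inv_mul_le_iff₀ hε]
      rw [ContinuousMap.one_apply, mul_one]
      exact abs_le.2 ⟨le_max_left _ _, max_le (by linarith) (min_le_right _ _)⟩
    rw [map_smul_eq_mul, norm_inv, Real.norm_of_nonneg hε.le, inv_mul_le_iff₀ hε] at hc
    have hrest : P (f - c) = 0 := by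
      refine hP.eq_zero_of_eqOn_isOpen (W := {x | |f x| < ε})
        (isOpen_lt (by fun_prop) continuous_const) (fun x hx => by simpa [hf x hx]) fun x hx => ?_
      obtain ⟨hlo, hhi⟩ : -ε < f x ∧ f x < ε := abs_lt.1 hx
      simp [c, min_eq_left hhi.le, max_eq_right hlo.le]
    calc P f = P (c + (f - c)) := by rw [add_sub_cancel]
      _ ≤ P c + P (f - c) := map_add_le_add P _ _
      _ ≤ ε * C := by rw [hrest, add_zero]; exact hc
  have hlim : Tendsto (fun ε => ε * C) (𝓝[>] 0) (𝓝 0) := by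
    simpa using ((continuous_mul_const C).tendsto 0).mono_left nhdsWithin_le_nhds
  exact (ge_of_tendsto hlim (eventually_mem_nhdsWithin.mono hle)).antisymm (apply_nonneg P f)

theorem IsOrderBounded.exists_isCompact_support (hP : IsOrderBounded P) :
    ∃ S : Set X, IsCompact S ∧ ∀ f : C(X, ℝ), (∀ x ∈ S, f x = 0) → P f = 0 :=
  ⟨seminormSupport P,
    isCompact_of_forall_bounded isClosed_seminormSupport (bounded_on_seminormSupport hP),
    fun _ => hP.eq_zero_of_eqOn_support⟩

end
end Support

section PolarPoints

variable {X E : Type*} [TopologicalSpace X] [AddCommGroup E] [Module ℝ E]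

/-- The points of `X` whose evaluation functional, transported to `E` along `Φ`, lies in the polar
of `U`. As `U` shrinks to zero, these sets exhaust `X` by compact sets. -/
def polarPoints (Φ : E ≃ₗ[ℝ] C(X, ℝ)) (U : Set E) : Set X := {x | ∀ e ∈ U, |Φ e x| ≤ 1}

theorem isClosed_polarPoints (Φ : E ≃ₗ[ℝ] C(X, ℝ)) (U : Set E) : IsClosed (polarPoints Φ U) := by
  simp only [polarPoints, ofPred_forall]
  exact isClosed_biInter fun e _ => isClosed_le (by fun_prop) continuous_const

theorem polarPoints_anti (Φ : E ≃ₗ[ℝ] C(X, ℝ)) : Antitone (polarPoints Φ) :=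
  fun _ _ h _ hx e he => hx e (h he)

variable [TopologicalSpace E] {Φ : E ≃ₗ[ℝ] C(X, ℝ)}

theorem bounded_on_polarPoints [ContinuousSMul ℝ E] {U : Set E} (hU : U ∈ 𝓝 0) (g : C(X, ℝ)) :
    ∃ M, ∀ x ∈ polarPoints Φ U, |g x| ≤ M := by
  have hlim : Tendsto (fun n : ℕ => (1 / ((n : ℝ) + 1)) • Φ.symm g) atTop (𝓝 0) := by
    simpa using (tendsto_one_div_add_atTop_nhds_zero_nat (𝕜 := ℝ)).smul_const (Φ.symm g)
  obtain ⟨n, hn⟩ := (hlim.eventually hU).exists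
  have hpos : (0 : ℝ) < n + 1 := by positivity
  refine ⟨n + 1, fun x hx => ?_⟩
  have hgx : |1 / ((n : ℝ) + 1) * g x| ≤ 1 := by simpa using hx _ hn
  rwa [abs_mul, abs_of_pos (one_div_pos.2 hpos), one_div, inv_mul_le_iff₀ hpos, mul_one] at hgx

theorem exists_dense_approx [IsTopologicalAddGroup E] [ContinuousSMul ℝ E] {U : Set E}
    (hU : U ∈ 𝓝 0) {D : ℕ → E} (hD : DenseRange D) (g : C(X, ℝ)) :
    ∃ i, ∀ x ∈ polarPoints Φ U, |g x - Φ (D i) x| ≤ 1 / 4 := by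
  have hcont : Continuous fun d => (4 : ℝ) • (Φ.symm g - d) := by fun_prop
  obtain ⟨_, ⟨i, rfl⟩, hi⟩ := hD.inter_nhds_nonempty
    (hcont.continuousAt.preimage_mem_nhds (x := Φ.symm g) (by simpa using hU))
  refine ⟨i, fun x hx => ?_⟩
  have h4 : |4 * (g x - Φ (D i) x)| ≤ 1 := by simpa using hx _ hi
  rw [abs_mul, abs_of_pos four_pos] at h4
  linarith

theorem secondCountableTopology_polarPoints [IsTopologicalAddGroup E] [ContinuousSMul ℝ E]
    [TopologicalSpace.SeparableSpace E] [CompletelyRegularSpace X] {U : Set E} (hU : U ∈ 𝓝 0) :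
    SecondCountableTopology (polarPoints Φ U) := by
  obtain ⟨D, hD⟩ := TopologicalSpace.exists_dense_seq E
  let ι : polarPoints Φ U → ℕ → ℝ := fun x i => Φ (D i) x
  have hcont : Continuous ι := by fun_prop
  have hι : IsInducing ι := by
    refine isInducing_iff_nhds.2 fun x => (hcont.tendsto x).le_comap.antisymm fun N hN => ?_
    obtain ⟨W, hWN, ⟨V, hV, rfl⟩, hxV⟩ := mem_nhds_iff.1 hN
    obtain ⟨f, -, hfx, hfV⟩ := exists_bump hV hxV
    obtain ⟨i, hi⟩ := exists_dense_approx (Φ := Φ) hU hD f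
    have hO : IsOpen {s : ℕ → ℝ | |s i - ι x i| < 1 / 4} := isOpen_lt (by fun_prop) (by fun_prop)
    refine ⟨_, hO.mem_nhds (by simp), fun y hy => hWN ?_⟩
    by_contra hyV
    have hxy : |Φ (D i) y - Φ (D i) x| < 1 / 4 := hy
    have hfy := hi y y.2
    have hfx' := hi x x.2
    rw [hfV y hyV] at hfy
    rw [hfx] at hfx'
    linarith [abs_lt.1 hxy, abs_le.1 hfy, abs_le.1 hfx']
  exact hι.secondCountableTopology

theorem exists_mem_polarPoints (hΦ : ∀ x, Continuous fun e => Φ e x) {U : ℕ → Set E}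
    (hU : (𝓝 (0 : E)).HasAntitoneBasis U) (x : X) : ∃ n, x ∈ polarPoints Φ (U n) := by
  have hx : {e | |Φ e x| < 1} ∈ 𝓝 (0 : E) :=
    (isOpen_lt (hΦ x).abs continuous_const).mem_nhds (by simp)
  obtain ⟨n, hn⟩ := hU.mem_iff.1 hx
  exact ⟨n, fun e he => (hn he).le⟩

theorem iUnion_polarPoints (hΦ : ∀ x, Continuous fun e => Φ e x) {U : ℕ → Set E}
    (hU : (𝓝 (0 : E)).HasAntitoneBasis U) : ⋃ n, polarPoints Φ (U n) = univ :=
  iUnion_eq_univ_iff.2 (exists_mem_polarPoints hΦ hU)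

theorem exists_subset_polarPoints [BarrelledSpace ℝ E] (hΦ : ∀ x, Continuous fun e => Φ e x)
    {U : ℕ → Set E} (hU : (𝓝 (0 : E)).HasAntitoneBasis U) {C : Set X} (hC : IsCompact C) :
    ∃ n, C ⊆ polarPoints Φ (U n) := by
  let p : C → Seminorm ℝ E := fun x =>
    (normSeminorm ℝ ℝ).comp ((ContinuousMap.evalCLM ℝ (x : X)).toLinearMap ∘ₗ Φ.toLinearMap)
  have hbdd : BddAbove (range p) := by
    rw [Seminorm.bddAbove_range_iff]
    intro e
    obtain ⟨M, hM⟩ := hC.exists_bound_of_continuousOn (Φ e).continuous.continuousOn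
    exact ⟨M, forall_mem_range.2 fun x => hM x x.2⟩
  have hcont : Continuous (⨆ x, p x : Seminorm ℝ E) := by
    rw [Seminorm.coe_iSup_eq hbdd]
    exact Seminorm.continuous_iSup p (fun x => (hΦ x).norm) hbdd
  obtain ⟨n, hn⟩ := hU.mem_iff.1
    ((isOpen_lt hcont continuous_const).mem_nhds (show (⨆ x, p x) 0 < 1 by simp))
  exact ⟨n, fun x hx e he => (le_ciSup hbdd ⟨x, hx⟩ e).trans (hn he).le⟩

theorem isSubmetrizable_of_separableSpace [T35Space X] [TopologicalSpace.SeparableSpace E]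
    (hΦ : ∀ x, Continuous fun e => Φ e x) : IsSubmetrizable X := by
  obtain ⟨D, hD⟩ := TopologicalSpace.exists_dense_seq E
  let ι : X → ℕ → ℝ := fun x i => Φ (D i) x
  have hcont : Continuous ι := by fun_prop
  have hinj : Function.Injective ι := by
    intro x y hxy
    have heval : ∀ f : C(X, ℝ), f x = f y := fun f => by
      simpa using congrFun (hD.equalizer (hΦ x) (hΦ y) (funext (congrFun hxy))) (Φ.symm f)
    by_contra hne
    obtain ⟨f, -, hfx, hfV⟩ := exists_bump isOpen_compl_singleton hne
    exact one_ne_zero (hfx ▸ heval f ▸ hfV y (not_not.2 rfl))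
  let _ := TopologicalSpace.metrizableSpaceMetric (ℕ → ℝ)
  exact ⟨fun x y => dist (ι x) (ι y), by fun_prop, fun x y => dist_eq_zero.trans hinj.eq_iff,
    fun x y => dist_comm _ _, fun x y z => dist_triangle _ _ _⟩

section Cover

variable [IsTopologicalAddGroup E] [ContinuousSMul ℝ E] [SecondCountableTopology E]
  [CompletelyRegularSpace X]

theorem lindelofSpace_of_linearEquiv (hΦ : ∀ x, Continuous fun e => Φ e x) : LindelofSpace X := by
  obtain ⟨U, hU⟩ := (𝓝 (0 : E)).exists_antitone_basis
  refine ⟨iUnion_polarPoints hΦ hU ▸ isLindelof_iUnion fun n => ?_⟩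
  have := secondCountableTopology_polarPoints (Φ := Φ) (hU.mem n)
  exact isLindelof_iff_lindelofSpace.2 inferInstance

theorem separableSpace_of_linearEquiv (hΦ : ∀ x, Continuous fun e => Φ e x) :
    TopologicalSpace.SeparableSpace X := by
  obtain ⟨U, hU⟩ := (𝓝 (0 : E)).exists_antitone_basis
  refine TopologicalSpace.isSeparable_univ_iff.1 (iUnion_polarPoints hΦ hU ▸ .iUnion fun n => ?_)
  have := secondCountableTopology_polarPoints (Φ := Φ) (hU.mem n)
  exact .of_subtype _

end Cover

section Polish

variable [IsTopologicalAddGroup E] [PolishSpace E]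

theorem continuous_symm_comp_mulLeft [TopologicalSpace.SeparableSpace X]
    (hΦ : ∀ x, Continuous fun e => Φ e x) (f : C(X, ℝ)) :
    Continuous (Φ.symm.toLinearMap ∘ₗ LinearMap.mulLeft ℝ f ∘ₗ
      BoundedContinuousFunction.toContinuousMapLinearMap X ℝ ℝ) := by
  set T := Φ.symm.toLinearMap ∘ₗ LinearMap.mulLeft ℝ f ∘ₗ
    BoundedContinuousFunction.toContinuousMapLinearMap X ℝ ℝ
  obtain ⟨D, hDc, hD⟩ := TopologicalSpace.exists_countable_dense X
  have := hDc.to_subtype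
  let j : E → D → ℝ := fun e d => Φ e d
  have hj : Continuous j := continuous_pi fun d => hΦ d
  have hinj : Function.Injective j := fun e e' hee' => Φ.injective <| DFunLike.coe_injective <|
    Continuous.ext_on hD (Φ e).continuous (Φ e').continuous fun d hd => congrFun hee' ⟨d, hd⟩
  refine continuous_of_comp_injective T.toAddMonoidHom hj hinj (continuous_pi fun d => ?_)
  have heval : ∀ g, Φ (T g) d = f d * g d := fun g => by simp [T]
  simp only [j, Function.comp_apply, LinearMap.toAddMonoidHom_coe, heval]
  fun_prop

-- Every `h` with `|h| ≤ f` is `|f| + 1` times a function of norm at most `1`.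
theorem isOrderBounded_comp_symm [TopologicalSpace.SeparableSpace X]
    (hΦ : ∀ x, Continuous fun e => Φ e x) {p : Seminorm ℝ E} (hp : Continuous p) :
    IsOrderBounded (p.comp Φ.symm.toLinearMap) := by
  intro f
  obtain ⟨C, hC0, hC⟩ := (p.comp _).bound_of_continuous_normedSpace
    (hp.comp (continuous_symm_comp_mulLeft hΦ (|f| + 1)))
  refine ⟨C, fun h hh => ?_⟩
  have hpos : ∀ x, 0 < |f x| + 1 := fun x => by positivity
  let g : BoundedContinuousFunction X ℝ := .ofNormedAddCommGroup (fun x => h x / (|f x| + 1))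
    (by fun_prop (disch := exact fun x => (hpos x).ne')) 1 fun x => by
      rw [Real.norm_eq_abs, abs_div, abs_of_pos (hpos x)]
      exact div_le_one_of_le₀ ((hh x).trans ((le_abs_self _).trans (lt_add_one _).le)) (hpos x).le
  have hgh : (|f| + 1) * g.toContinuousMap = h :=
    ContinuousMap.ext fun x => mul_div_cancel₀ (h x) (hpos x).ne'
  calc p (Φ.symm h) = p (Φ.symm ((|f| + 1) * g.toContinuousMap)) := by rw [hgh]
    _ ≤ C * ‖g‖ := hC g
    _ ≤ C := mul_le_of_le_one_right hC0.le
      (BoundedContinuousFunction.norm_ofNormedAddCommGroup_le _ zero_le_one _)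

variable [ContinuousSMul ℝ E]

theorem exists_eq_zero_of_eqOn_polarPoints [CompletelyRegularSpace X]
    (hΦ : ∀ x, Continuous fun e => Φ e x) {U : ℕ → Set E} (hU : (𝓝 (0 : E)).HasAntitoneBasis U)
    {p : Seminorm ℝ E} (hp : Continuous p) :
    ∃ m, ∀ e, (∀ x ∈ polarPoints Φ (U m), Φ e x = 0) → p e = 0 := by
  have := lindelofSpace_of_linearEquiv hΦ
  have := separableSpace_of_linearEquiv hΦ
  obtain ⟨S, hS, hpS⟩ := (isOrderBounded_comp_symm hΦ hp).exists_isCompact_support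
  obtain ⟨m, hm⟩ := exists_subset_polarPoints hΦ hU hS
  refine ⟨m, fun e he => ?_⟩
  simpa using hpS (Φ e) fun x hx => he x (hm hx)

theorem isCompact_polarPoints [CompletelyRegularSpace X] (hΦ : ∀ x, Continuous fun e => Φ e x)
    {U : Set E} (hU : U ∈ 𝓝 0) : IsCompact (polarPoints Φ U) := by
  have := lindelofSpace_of_linearEquiv hΦ
  exact isCompact_of_forall_bounded (isClosed_polarPoints Φ U) (bounded_on_polarPoints hU)

theorem isHemicompact_of_linearEquiv [CompletelyRegularSpace X]
    (hΦ : ∀ x, Continuous fun e => Φ e x) : IsHemicompact X := by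
  obtain ⟨U, hU⟩ := (𝓝 (0 : E)).exists_antitone_basis
  refine ⟨range fun n => polarPoints Φ (U n), countable_range _, ?_, fun C hC => ?_⟩
  · exact forall_mem_range.2 fun n => isCompact_polarPoints hΦ (hU.mem n)
  · obtain ⟨n, hn⟩ := exists_subset_polarPoints hΦ hU hC
    exact ⟨_, mem_range_self n, hn⟩

-- The preimages `Φ⁻¹ (f n)` form a Cauchy sequence: every continuous seminorm vanishes on the
-- differences of sufficiently late terms.
theorem exists_eqOn_polarPoints [LocallyConvexSpace ℝ E] [CompletelyRegularSpace X]
    (hΦ : ∀ x, Continuous fun e => Φ e x) {U : ℕ → Set E} (hU : (𝓝 (0 : E)).HasAntitoneBasis U)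
    {f : ℕ → C(X, ℝ)} (hf : ∀ m n, m ≤ n → EqOn (f n) (f m) (polarPoints Φ (U m))) :
    ∃ F : C(X, ℝ), ∀ n, EqOn F (f n) (polarPoints Φ (U n)) := by
  let _ : UniformSpace E := IsTopologicalAddGroup.rightUniformSpace E
  have : IsUniformAddGroup E := isUniformAddGroup_of_addCommGroup
  have : CompleteSpace E := completeSpace_of_isCompletelyMetrizableSpace
  have hcauchy : CauchySeq fun n => Φ.symm (f n) := by
    have hsemi := with_gaugeSeminormFamily (𝕜 := ℝ) (E := E)
    refine (IsUniformAddGroup.cauchy_map_iff_tendsto _ _).2 ⟨inferInstance, ?_⟩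
    refine (hsemi.tendsto_nhds _ 0).2 fun i ε hε => ?_
    obtain ⟨m, hm⟩ := exists_eq_zero_of_eqOn_polarPoints hΦ hU (hsemi.continuous_seminorm i)
    filter_upwards [(eventually_ge_atTop m).prod_mk (eventually_ge_atTop m)] with ⟨k, n⟩ hkn
    rw [sub_zero, hm _ fun x hx => by simp [hf m k hkn.1 hx, hf m n hkn.2 hx]]
    exact hε
  obtain ⟨e, he⟩ := cauchySeq_tendsto_of_complete hcauchy
  refine ⟨Φ e, fun m x hx => tendsto_nhds_unique (((hΦ x).tendsto e).comp he) ?_⟩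
  refine tendsto_const_nhds.congr' ?_
  filter_upwards [eventually_ge_atTop m] with n hmn
  simp [hf m n hmn hx]

end Polish
end PolarPoints

section Extension

theorem eqOn_of_forall_eqOn_succ {X Y : Type*} {K : ℕ → Set X} (hK : Monotone K) {f : ℕ → X → Y}
    (hf : ∀ n, EqOn (f (n + 1)) (f n) (K n)) {m n : ℕ} (hmn : m ≤ n) :
    EqOn (f n) (f m) (K m) := by
  induction n, hmn using Nat.le_induction with
  | base => exact eqOn_refl _ _
  | succ n hmn ih => exact ((hf n).mono (hK hmn)).trans ih

variable {X : Type*} [TopologicalSpace X] [NormalSpace X]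

theorem exists_eqOn_of_eqOn_inter {K L : Set X} (hK : IsClosed K) (hL : IsClosed L)
    {f g : C(X, ℝ)} (hfg : EqOn f g (K ∩ L)) :
    ∃ h : C(X, ℝ), EqOn h f K ∧ EqOn h g L := by
  classical
  have hφK : EqOn (L.piecewise g f) f K := fun x hx => by
    by_cases hxL : x ∈ L
    · simp [hxL, hfg ⟨hx, hxL⟩]
    · simp [hxL]
  have hφL : EqOn (L.piecewise g f) g L := piecewise_eqOn L g f
  have hφ : ContinuousOn (L.piecewise g f) (K ∪ L) :=
    (f.continuous.continuousOn.congr hφK).union_of_isClosed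
      (g.continuous.continuousOn.congr hφL) hK hL
  obtain ⟨h, hh⟩ := ContinuousMap.exists_restrict_eq (hK.union hL) ⟨_, hφ.domRestrict⟩
  have heq : EqOn h (L.piecewise g f) (K ∪ L) := fun x hx => DFunLike.congr_fun hh ⟨x, hx⟩
  exact ⟨h, (heq.mono subset_union_left).trans hφK, (heq.mono subset_union_right).trans hφL⟩

theorem exists_separating_sequence [T1Space X] {F : Set X} {K : ℕ → Set X}
    (hK : ∀ n, IsClosed (K n)) (hFK : ∀ n, IsClosed (K n ∩ F)) {x : X} (hx : x ∉ F) :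
    ∃ f : ℕ → C(X, ℝ), (∀ n, f n x = 0) ∧ (∀ n, EqOn (f n) 1 (K n ∩ F)) ∧
      ∀ n, EqOn (f (n + 1)) (f n) (K n) := by
  have hstep : ∀ (f : C(X, ℝ)) {A : Set X} (n : ℕ), IsClosed A → f x = 0 → EqOn f 1 (A ∩ F) →
      ∃ g : C(X, ℝ), g x = 0 ∧ EqOn g 1 (K n ∩ F) ∧ EqOn g f A := by
    intro f A n hA hfx hf
    have hfg : EqOn f (1 : C(X, ℝ)) (insert x A ∩ (K n ∩ F)) := by
      rintro y ⟨rfl | hy, hyF⟩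
      · exact (hx hyF.2).elim
      · exact hf ⟨hy, hyF.2⟩
    obtain ⟨g, hgf, hg⟩ := exists_eqOn_of_eqOn_inter
      (insert_eq x A ▸ isClosed_singleton.union hA) (hFK n) hfg
    exact ⟨g, (hgf (mem_insert x A)).trans hfx, hg, hgf.mono (subset_insert x A)⟩
  obtain ⟨f₀, hf₀x, hf₀, -⟩ := hstep 0 0 isClosed_empty rfl (by simp)
  choose! s hsx hs hsf using fun n (f : C(X, ℝ)) => hstep f (n + 1) (hK n)
  let f : ℕ → C(X, ℝ) := fun n => Nat.rec f₀ s n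
  have hf : ∀ n, f n x = 0 ∧ EqOn (f n) 1 (K n ∩ F) := fun n => by
    induction n with
    | zero => exact ⟨hf₀x, hf₀⟩
    | succ n ih => exact ⟨hsx n _ ih.1 ih.2, hs n _ ih.1 ih.2⟩
  exact ⟨f, fun n => (hf n).1, fun n => (hf n).2, fun n => hsf n _ (hf n).1 (hf n).2⟩

end Extension

section

variable {X E : Type*} [TopologicalSpace X] [T35Space X] [AddCommGroup E] [Module ℝ E]
  [τ : TopologicalSpace E] {Φ : E ≃ₗ[ℝ] C(X, ℝ)}

theorem isKSpace_of_linearEquiv [IsTopologicalAddGroup E] [ContinuousSMul ℝ E]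
    [LocallyConvexSpace ℝ E] [PolishSpace E] (hΦ : ∀ x, Continuous fun e => Φ e x) :
    IsKSpace X := by
  have := lindelofSpace_of_linearEquiv hΦ
  obtain ⟨U, hU⟩ := (𝓝 (0 : E)).exists_antitone_basis
  refine fun F => ⟨fun hF K _ => hF.preimage continuous_subtype_val, fun hF => ?_⟩
  have hFU : ∀ n, IsClosed (polarPoints Φ (U n) ∩ F) := fun n => by
    have hclosed := (isClosed_polarPoints Φ (U n)).isClosedMap_subtype_val _
      (hF _ (isCompact_polarPoints hΦ (hU.mem n)))
    rwa [Subtype.image_preimage_coe] at hclosed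
  rw [← isOpen_compl_iff, isOpen_iff_mem_nhds]
  intro x hxF
  obtain ⟨f, hfx, hfF, hf⟩ :=
    exists_separating_sequence (fun n => isClosed_polarPoints Φ (U n)) hFU hxF
  obtain ⟨G, hG⟩ := exists_eqOn_polarPoints hΦ hU fun m n hmn =>
    eqOn_of_forall_eqOn_succ ((polarPoints_anti Φ).comp hU.antitone) (f := fun n => f n) hf hmn
  have hGx : G x ≠ 1 := by
    obtain ⟨n, hn⟩ := exists_mem_polarPoints hΦ hU x
    simp [hG n hn, hfx n]
  filter_upwards [(isOpen_ne_fun G.continuous continuous_const).mem_nhds hGx] with y hy hyF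
  obtain ⟨n, hn⟩ := exists_mem_polarPoints hΦ hU y
  exact hy ((hG n hn).trans (hfF n ⟨hn, hyF⟩))

theorem IsFrechet.polishSpace [TopologicalSpace.SeparableSpace E] (h : IsFrechet E) :
    PolishSpace E := by
  have := h.isTopologicalAddGroup
  have := h.metrizableSpace
  let _ : UniformSpace E := IsTopologicalAddGroup.rightUniformSpace E
  have : IsUniformAddGroup E := isUniformAddGroup_of_addCommGroup
  have : CompleteSpace E := h.completeSpace
  have : (𝓤 E).IsCountablyGenerated := IsUniformAddGroup.uniformity_countably_generated
  have := UniformSpace.secondCountable_of_separable E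
  infer_instance

theorem IsFrechet.submetrizable_hemicompact_kSpace [TopologicalSpace.SeparableSpace E]
    (h : IsFrechet E) (hΦ : ∀ x, Continuous fun e => Φ e x) :
    IsSubmetrizable X ∧ IsHemicompact X ∧ IsKSpace X := by
  have := h.isTopologicalAddGroup
  have := h.continuousSMul
  have := h.locallyConvexSpace
  have := h.polishSpace
  exact ⟨isSubmetrizable_of_separableSpace hΦ, isHemicompact_of_linearEquiv hΦ,
    isKSpace_of_linearEquiv hΦ⟩

theorem IsPolishable.submetrizable_hemicompact_kSpace
    (h : IsPolishable C(X, ℝ) (pointwiseTopology X)) :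
    IsSubmetrizable X ∧ IsHemicompact X ∧ IsKSpace X := by
  obtain ⟨τ, hτ, hF, hs⟩ := h
  have hcoe := continuous_iff_le_induced.2 hτ
  exact IsFrechet.submetrizable_hemicompact_kSpace (E := C(X, ℝ)) (τ := τ)
    (Φ := LinearEquiv.refl ℝ _) hF fun x => (continuous_apply x).comp hcoe

end

section

variable {X : Type*} [TopologicalSpace X]

theorem isPolishable_of_polishSpace [PolishSpace C(X, ℝ)] :
    IsPolishable C(X, ℝ) (pointwiseTopology X) := by
  refine ⟨inferInstance, continuous_iff_le_induced.1 continuous_coeFun,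
    ⟨inferInstance, inferInstance, inferInstance, inferInstance, ?_⟩, inferInstance⟩
  let _ : UniformSpace C(X, ℝ) := IsTopologicalAddGroup.rightUniformSpace C(X, ℝ)
  have : IsUniformAddGroup C(X, ℝ) := isUniformAddGroup_of_addCommGroup
  exact completeSpace_of_isCompletelyMetrizableSpace

-- Embed `K` into the metric space `C(K, ℝ)` by `x ↦ d x`.
theorem IsSubmetrizable.metrizableSpace_of_isCompact (h : IsSubmetrizable X) {K : Set X}
    (hK : IsCompact K) : TopologicalSpace.MetrizableSpace K := by
  obtain ⟨d, hd, hd0, -⟩ := h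
  have : CompactSpace K := isCompact_iff_compactSpace.1 hK
  let ι : C(K, C(K, ℝ)) := ContinuousMap.curry ⟨fun p => d p.1 p.2, by fun_prop⟩
  have hinj : Function.Injective ι := by
    intro x y hxy
    have hdxy : d x y = d y y := DFunLike.congr_fun hxy y
    exact Subtype.ext ((hd0 x y).1 (hdxy.trans ((hd0 y y).2 rfl)))
  exact (ι.continuous.isClosedEmbedding hinj).isEmbedding.metrizableSpace

theorem IsSubmetrizable.secondCountableTopology_continuousMap (h : IsSubmetrizable X) {K : Set X}
    (hK : IsCompact K) : SecondCountableTopology C(K, ℝ) := by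
  have : CompactSpace K := isCompact_iff_compactSpace.1 hK
  have := h.metrizableSpace_of_isCompact hK
  let _ := TopologicalSpace.metrizableSpaceMetric K
  infer_instance

theorem compactOpen_eq_iInf_induced_of_cofinal {Y : Type*} [TopologicalSpace Y] {𝒦 : Set (Set X)}
    (hcof : ∀ C, IsCompact C → ∃ K ∈ 𝒦, C ⊆ K) :
    (ContinuousMap.compactOpen : TopologicalSpace C(X, Y)) =
      ⨅ K : 𝒦, .induced (ContinuousMap.restrict (K : Set X)) ContinuousMap.compactOpen := by
  refine le_antisymm (le_iInf fun K => ContinuousMap.compactOpen_le_induced _) ?_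
  rw [ContinuousMap.compactOpen_eq_iInf_induced]
  refine le_iInf₂ fun C hC => ?_
  obtain ⟨K, hK, hCK⟩ := hcof C hC
  refine (iInf_le _ ⟨K, hK⟩).trans ?_
  have hrestrict : Continuous fun f : C(K, Y) => f.comp (.inclusion hCK) :=
    ContinuousMap.continuous_precomp _
  calc TopologicalSpace.induced (ContinuousMap.restrict K) ContinuousMap.compactOpen
    _ ≤ .induced (ContinuousMap.restrict K) (.induced _ ContinuousMap.compactOpen) :=
      induced_mono hrestrict.le_induced
    _ = .induced (ContinuousMap.restrict C) ContinuousMap.compactOpen := induced_compose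

theorem isUniformAddGroup_continuousMap {G : Type*} [AddGroup G] [UniformSpace G]
    [IsUniformAddGroup G] : IsUniformAddGroup C(X, G) :=
  let φ : C(X, G) →+ UniformOnFun X G {K | IsCompact K} :=
    { toFun := ContinuousMap.toUniformOnFunIsCompact
      map_zero' := rfl
      map_add' := fun _ _ => rfl }
  IsUniformInducing.isUniformAddGroup φ
    ContinuousMap.isUniformEmbedding_toUniformOnFunIsCompact.isUniformInducing

theorem polishSpace_of_submetrizable_hemicompact_kSpace (hs : IsSubmetrizable X)
    (hh : IsHemicompact X) (hk : IsKSpace X) : PolishSpace C(X, ℝ) := by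
  obtain ⟨𝒦, h𝒦, hcpt, hcof⟩ := hh
  have : SecondCountableTopology C(X, ℝ) := by
    have : Countable 𝒦 := h𝒦.to_subtype
    rw [compactOpen_eq_iInf_induced_of_cofinal hcof]
    refine TopologicalSpace.secondCountableTopology_iInf fun K => ?_
    have := hs.secondCountableTopology_continuousMap (hcpt K K.2)
    exact TopologicalSpace.secondCountableTopology_induced _ _ _
  have : CompactlyCoherentSpace X := .of_isClosed fun F hF => (hk F).2 hF
  have : IsUniformAddGroup C(X, ℝ) := isUniformAddGroup_continuousMap
  have : (𝓤 C(X, ℝ)).IsCountablyGenerated := IsUniformAddGroup.uniformity_countably_generated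
  infer_instance

end

end FunctionSpace

theorem theorem2p5 (X : Type*) [TopologicalSpace X] [T35Space X] :
    List.TFAE [
      FunctionSpace.IsPolishable C(X, ℝ) (FunctionSpace.pointwiseTopology X),
      PolishSpace C(X, ℝ),
      FunctionSpace.IsSubmetrizable X ∧ FunctionSpace.IsHemicompact X ∧
        FunctionSpace.IsKSpace X] := by
  tfae_have 1 → 3 := FunctionSpace.IsPolishable.submetrizable_hemicompact_kSpace
  tfae_have 3 → 2 := fun ⟨hs, hh, hk⟩ =>
    FunctionSpace.polishSpace_of_submetrizable_hemicompact_kSpace hs hh hk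
  tfae_have 2 → 1 := fun _ => FunctionSpace.isPolishable_of_polishSpace
  tfae_finish
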